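/- Let $[k]^n$ be the set of words of length $n$ over a $k$-letter alphabet. A word in $[k]^n$ is balanced if all $k$ letters occur in it equally often (hence $n/k$ times each); $B_k^n$ denotes the set of balanced words in $[k]^n$, which is nonempty if and only if $k\mid n$. For words $w,w'$ let $\mathrm{LCS}(w,w')$ be the length of a longest common (not necessarily contiguous) subsequence of $w$ and $w'$. For $t\ge 2$ and a nonempty set $\mathcal F$ of words let $\mathrm{LCS}(t,\mathcal F)=\min\max_{i\ne j}\mathrm{LCS}(w_i,w_j)$, where the minimum is over all $t$-tuples $(w_1,\dots,w_t)\in\mathcal F^t$ (repetitions allowed). Theorem. There are absolute constants $0<a\le b$ such that for all integers $k\ge 2$ and $r\ge 1$ there is a real number $c'$, depending only on $k$ and $r$, with $a\,r^{-9}k^{1/r-1}\le c'\le b\,r^{-9}k^{1/r-1}$ (that is, $c'=\Theta(r^{-9}k^{1/r-1})$), such that for every integer $n\ge k(10r)^{9r}/2$ divisible by $k$, $$\mathrm{LCS}(r+2,B_k^n)\ \ge\ \frac nk+c'\,n^{1-1/r}.$$ Moreover, for $r=0$ the bound holds without the second term: $\mathrm{LCS}(2,B_k^n)\ge n/k$ for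 all $k\ge2$ and all integers $n\ge 0$ divisible by $k$. -/

import Mathlib

/-- `[k]^n`: the words of length `n` over a `k`-letter alphabet. -/
def wordsOfLength (k n : ℕ) : Set (List (Fin k)) := {w | w.length = n}

/-- A word over a `k`-letter alphabet is balanced if all letters occur in it equally often. -/
def IsBalanced {k : ℕ} (w : List (Fin k)) : Prop := ∀ i j : Fin k, w.count i = w.count j

/-- `B_k^n`: the balanced words in `[k]^n`. -/
def balancedWords (k n : ℕ) : Set (List (Fin k)) := {w | w ∈ wordsOfLength k n ∧ IsBalanced w}

/-- `LCS(w, w')`: the largest length of a common subsequence of two words (a subsequence need not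
be contiguous). The supremum is over a nonempty set bounded by `w.length`, so it is a maximum. -/
noncomputable def lcs {α : Type*} (w w' : List α) : ℕ :=
  sSup {m | ∃ s : List α, s.Sublist w ∧ s.Sublist w' ∧ s.length = m}

/-- `LCS(𝒲)` for a family `𝒲` of `t` words, repetitions allowed: the largest `LCS` of two
members with different indices. The set is finite, and nonempty if `2 ≤ t`. -/
noncomputable def lcsFamily {α : Type*} {t : ℕ} (W : Fin t → List α) : ℕ :=
  sSup {m | ∃ i j : Fin t, i ≠ j ∧ lcs (W i) (W j) = m}

/-- `LCS(t, ℱ)`: the smallest `LCS(𝒲)` over all `t`-tuples `𝒲` of words from `ℱ`. This is a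
minimum whenever `ℱ` is nonempty. -/
noncomputable def lcsMin {α : Type*} (t : ℕ) (F : Set (List α)) : ℕ :=
  sInf {m | ∃ W : Fin t → List α, (∀ i, W i ∈ F) ∧ lcsFamily W = m}

/-! Only two letters `a`, `b` matter. Each occurs `m = n / k` times, so a word reduces to its
profile: the numbers `x i` of letters `b` between consecutive letters `a`. Matching all `a`'s gives
length `m`. The aim is to gain by switching to `b`'s on intervals where both words are rich in `b`.

Suppose every pair has LCS below `m + d`, and take intervals of length `2 ^ q` comparable to `d`.
Switching between `a` and `b` once shows that on each interval all but two words have at least half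
the average mass of `b` (`card_le_card_filter_add_two`). In such a word, maximal heavy dyadic
intervals cover a constant fraction (`two_pow_le_heavySum`). With `r + 2 = p + 3` words and the
dyadic scales cut into `p` classes, two of the `p + 1` remaining words have much of their heavy part
in the same class, where lengths differ by a factor of at most `2 ^ (q / p)`.

Sliding one word along the other, a heavy interval of length `2 ^ s` meets a heavy interval at least
as long for about `2 ^ s` shifts, and each meeting gains `2 ^ s` (`sum_le_sum_shiftGain`). Averaging
over shifts and pairs, and adding over all intervals, bounds `m` by a multiple of `(p + 1) ^ 4 * d ^
(1 + 1 / p)` (`lt_mul_of_lcs_lt`), so `d` has order at least `m ^ (1 - 1 / r)` for fixed `r`. For `r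
= 1` a pigeonhole on the first block suffices. -/

/-! ### Common subsequences under concatenation. -/

section CommonSubsequence

variable {α : Type*}

/-- The words `u` and `v` have a common subsequence of length at least `n`. -/
def HasCommonSub (n : ℕ) (u v : List α) : Prop :=
  ∃ s : List α, s.Sublist u ∧ s.Sublist v ∧ n ≤ s.length

theorem HasCommonSub.append {n n' : ℕ} {u v u' v' : List α} (h : HasCommonSub n u v)
    (h' : HasCommonSub n' u' v') : HasCommonSub (n + n') (u ++ u') (v ++ v') := by
  obtain ⟨s, hu, hv, hn⟩ := h
  obtain ⟨s', hu', hv', hn'⟩ := h'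
  exact ⟨s ++ s', hu.append hu', hv.append hv', by simp; omega⟩

theorem HasCommonSub.mono {n n' : ℕ} {u v u' v' : List α} (h : HasCommonSub n u v)
    (hn : n' ≤ n) (hu : u.Sublist u') (hv : v.Sublist v') : HasCommonSub n' u' v' := by
  obtain ⟨s, h1, h2, h3⟩ := h
  exact ⟨s, h1.trans hu, h2.trans hv, hn.trans h3⟩

theorem hasCommonSub_replicate {u v : List α} {a : α} {n n' : ℕ}
    (hu : (List.replicate n a).Sublist u) (hv : (List.replicate n' a).Sublist v) :
    HasCommonSub (min n n') u v :=
  ⟨List.replicate (min n n') a,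
    ((List.replicate_sublist_replicate a).2 (min_le_left _ _)).trans hu,
    ((List.replicate_sublist_replicate a).2 (min_le_right _ _)).trans hv, by simp⟩

theorem HasCommonSub.le_lcs {n : ℕ} {u v : List α} (h : HasCommonSub n u v) : n ≤ lcs u v := by
  obtain ⟨s, hu, hv, hn⟩ := h
  refine hn.trans (le_csSup ⟨u.length, ?_⟩ ⟨s, hu, hv, rfl⟩)
  rintro _ ⟨t, ht, -, rfl⟩
  exact ht.length_le

end CommonSubsequence

/-! ### Reduction to two letters: words as sequences of blocks. -/

section Blocks

/-- The sum of `x` over `[i, i + n)`. -/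
def blockSum (x : ℕ → ℕ) (i n : ℕ) : ℕ := ∑ j ∈ Finset.range n, x (i + j)

theorem blockSum_add (x : ℕ → ℕ) (i n k : ℕ) :
    blockSum x i (n + k) = blockSum x i n + blockSum x (i + n) k := by
  simp [blockSum, Finset.sum_range_add, add_assoc]

theorem blockSum_le_blockSum (x : ℕ → ℕ) {i n j k : ℕ} (h1 : j ≤ i) (h2 : i + n ≤ j + k) :
    blockSum x i n ≤ blockSum x j k := by
  obtain ⟨p, rfl⟩ := Nat.exists_eq_add_of_le h1
  obtain ⟨q, rfl⟩ : ∃ q, k = p + n + q := ⟨k - (p + n), by omega⟩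
  rw [blockSum_add, blockSum_add]
  omega

variable {α : Type*} (a b : α)

/-- The word `b ^ x i · a · b ^ x (i + 1) · a ⋯ b ^ x (i + n - 1) · a`. -/
def blockWord (x : ℕ → ℕ) : ℕ → ℕ → List α
  | _, 0 => []
  | i, n + 1 => List.replicate (x i) b ++ a :: blockWord x (i + 1) n

theorem blockWord_add (x : ℕ → ℕ) (i n k : ℕ) :
    blockWord a b x i (n + k) = blockWord a b x i n ++ blockWord a b x (i + n) k := by
  induction n generalizing i with
  | zero => simp [blockWord]
  | succ n ih =>
    rw [show n + 1 + k = (n + k) + 1 by ring]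
    simp [blockWord, ih, add_assoc, add_comm 1 n]

theorem replicate_fst_sublist_blockWord (x : ℕ → ℕ) (i n : ℕ) :
    (List.replicate n a).Sublist (blockWord a b x i n) := by
  induction n generalizing i with
  | zero => simp
  | succ n ih =>
    rw [List.replicate_succ, blockWord]
    exact ((ih (i + 1)).cons_cons a).trans (List.sublist_append_right _ _)

theorem replicate_snd_sublist_blockWord (x : ℕ → ℕ) (i n : ℕ) :
    (List.replicate (blockSum x i n) b).Sublist (blockWord a b x i n) := by
  induction n generalizing i with
  | zero => simp [blockSum]
  | succ n ih =>
    rw [add_comm n 1, blockSum_add, List.replicate_add, add_comm 1 n, blockWord]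
    refine List.Sublist.append ?_ ((ih (i + 1)).cons a)
    simp [blockSum]

theorem hasCommonSub_blockWord_fst (x y : ℕ → ℕ) (i j n k : ℕ) :
    HasCommonSub (min n k) (blockWord a b x i n) (blockWord a b y j k) :=
  hasCommonSub_replicate (replicate_fst_sublist_blockWord a b x i n)
    (replicate_fst_sublist_blockWord a b y j k)

/-- Both words end in `a`, so one `a` can follow the common `b`'s. This extra letter makes a single
block with one `b` profitable: `ba` instead of `a`. -/
theorem hasCommonSub_blockWord_snd (x y : ℕ → ℕ) (i j : ℕ) {n : ℕ} (hn : 0 < n) :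
    HasCommonSub (min (blockSum x i n) (blockSum y j n) + 1)
      (blockWord a b x i n) (blockWord a b y j n) := by
  have key : ∀ (z : ℕ → ℕ) (i : ℕ),
      (List.replicate (blockSum z i n) b ++ [a]).Sublist (blockWord a b z i n) := by
    intro z i
    obtain ⟨k, rfl⟩ : ∃ k, n = k + 1 := ⟨n - 1, by omega⟩
    rw [blockSum_add, List.replicate_add, blockWord_add, List.append_assoc]
    refine (replicate_snd_sublist_blockWord a b z i k).append ?_
    simp [blockWord, blockSum]
  have hle : ∀ s t : ℕ, s ≤ t →
      (List.replicate s b ++ [a]).Sublist (List.replicate t b ++ [a]) := fun s t h =>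
    ((List.replicate_sublist_replicate b).2 h).append (List.Sublist.refl _)
  exact ⟨List.replicate (min (blockSum x i n) (blockSum y j n)) b ++ [a],
    (hle _ _ (min_le_left _ _)).trans (key x i), (hle _ _ (min_le_right _ _)).trans (key y j),
    by simp⟩

/-- Every word contains the subsequence formed by its letters `a` and `b`. -/
theorem exists_blockWord_sublist [DecidableEq α] {a b : α} (hab : a ≠ b) (w : List α) :
    ∃ x : ℕ → ℕ, (blockWord a b x 0 (w.count a) ++ List.replicate (x (w.count a)) b).Sublist w ∧
      blockSum x 0 (w.count a + 1) = w.count b := by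
  induction w with
  | nil => exact ⟨0, by simp [blockWord], by simp [blockSum]⟩
  | cons c w ih =>
    obtain ⟨x, hx, hs⟩ := ih
    have shift : ∀ (f g : ℕ → ℕ) (n i j : ℕ), (∀ k, k < n → f (i + k) = g (j + k)) →
        blockWord a b f i n = blockWord a b g j n := by
      intro f g n
      induction n with
      | zero => intros; rfl
      | succ n ih =>
        intro i j h
        have h0 := h 0 (by omega)
        simp only [add_zero] at h0
        rw [blockWord, blockWord, h0, ih (i + 1) (j + 1)]
        intro k hk
        have := h (k + 1) (by omega)
        rwa [show i + 1 + k = i + (k + 1) by ring, show j + 1 + k = j + (k + 1) by ring]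
    by_cases hca : c = a
    · subst hca
      -- A leading `a` opens a new empty block in front and shifts all the others.
      refine ⟨fun i => i.casesOn 0 x, ?_, ?_⟩
      · rw [List.count_cons_self, blockWord]
        rw [shift _ x (w.count c) (0 + 1) 0 (fun k _ => by rw [zero_add, zero_add, add_comm 1 k])]
        exact hx.cons_cons c
      · rw [List.count_cons_self, List.count_cons_of_ne hab, ← hs,
          blockSum, Finset.sum_range_succ']
        simp [blockSum]
    · by_cases hcb : c = b
      · subst hcb
        refine ⟨fun i => if i = 0 then x 0 + 1 else x i, ?_, ?_⟩
        · rw [List.count_cons_of_ne hca]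
          cases hm : w.count a with
          | zero =>
            rw [hm] at hx
            simpa [blockWord, List.replicate_succ] using hx
          | succ n =>
            rw [hm] at hx
            rw [blockWord] at hx ⊢
            rw [shift _ x n (0 + 1) (0 + 1) (fun k _ => if_neg (by omega))]
            simpa [List.replicate_succ] using hx
        · rw [List.count_cons_of_ne hca, List.count_cons_self, ← hs, blockSum, blockSum,
            Finset.sum_range_succ', Finset.sum_range_succ']
          simp
          ring
      · refine ⟨x, ?_, ?_⟩
        · rw [List.count_cons_of_ne hca]
          exact hx.cons c
        · rw [List.count_cons_of_ne hca, List.count_cons_of_ne hcb, hs]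

end Blocks

/-! ### Maximal heavy dyadic intervals and the gain they give. -/

section DyadicIntervals

/-- The dyadic interval `[i, i + 2 ^ s)` carries a mass of `x` that is large for its length. -/
def Heavy (x : ℕ → ℕ) (i s : ℕ) : Prop :=
  (s = 0 ∧ 1 ≤ blockSum x i 1) ∨ 8 * 2 ^ s ≤ blockSum x i (2 ^ s)

open Classical in
/-- The sum of `f j s` over the maximal heavy intervals `[j, j + 2 ^ s)` among those obtained from
`[i, i + 2 ^ q)` by repeated halving. -/
noncomputable def heavySum (x : ℕ → ℕ) (f : ℕ → ℕ → ℕ) : ℕ → ℕ → ℕ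
  | 0, i => if Heavy x i 0 then f i 0 else 0
  | q + 1, i => if Heavy x i (q + 1) then f i (q + 1)
      else heavySum x f q i + heavySum x f q (i + 2 ^ q)

theorem heavySum_of_heavy {x : ℕ → ℕ} {i q : ℕ} (f : ℕ → ℕ → ℕ) (h : Heavy x i q) :
    heavySum x f q i = f i q := by
  cases q <;> simp [heavySum, h]

theorem heavySum_zero_of_not {x : ℕ → ℕ} {i : ℕ} (f : ℕ → ℕ → ℕ) (h : ¬ Heavy x i 0) :
    heavySum x f 0 i = 0 := by
  simp [heavySum, h]

theorem heavySum_succ_of_not {x : ℕ → ℕ} {i q : ℕ} (f : ℕ → ℕ → ℕ) (h : ¬ Heavy x i (q + 1)) :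
    heavySum x f (q + 1) i = heavySum x f q i + heavySum x f q (i + 2 ^ q) := by
  simp [heavySum, h]

theorem heavySum_mono {x : ℕ → ℕ} {f g : ℕ → ℕ → ℕ} {q i : ℕ}
    (h : ∀ j s, s ≤ q → i ≤ j → j < i + 2 ^ q → f j s ≤ g j s) :
    heavySum x f q i ≤ heavySum x g q i := by
  induction q generalizing i with
  | zero =>
    by_cases hh : Heavy x i 0
    · rw [heavySum_of_heavy f hh, heavySum_of_heavy g hh]
      exact h i 0 le_rfl le_rfl (by simp)
    · rw [heavySum_zero_of_not f hh, heavySum_zero_of_not g hh]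
  | succ q ih =>
    by_cases hh : Heavy x i (q + 1)
    · rw [heavySum_of_heavy f hh, heavySum_of_heavy g hh]
      exact h i _ le_rfl le_rfl (by simp)
    · rw [heavySum_succ_of_not f hh, heavySum_succ_of_not g hh]
      have h2 : 2 ^ (q + 1) = 2 ^ q + 2 ^ q := by ring
      exact add_le_add (ih fun j s h1 h3 h4 => h j s (by omega) h3 (by omega))
        (ih fun j s h1 h3 h4 => h j s (by omega) (by omega) (by omega))

theorem heavySum_congr {x : ℕ → ℕ} {f g : ℕ → ℕ → ℕ} {q i : ℕ}
    (h : ∀ j s, s ≤ q → f j s = g j s) : heavySum x f q i = heavySum x g q i :=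
  le_antisymm (heavySum_mono fun j s hs _ _ => (h j s hs).le)
    (heavySum_mono fun j s hs _ _ => (h j s hs).ge)

theorem heavySum_sum {ι : Type*} (x : ℕ → ℕ) (E : Finset ι) (f : ι → ℕ → ℕ → ℕ) (q i : ℕ) :
    heavySum x (fun j s => ∑ e ∈ E, f e j s) q i = ∑ e ∈ E, heavySum x (f e) q i := by
  induction q generalizing i with
  | zero =>
    by_cases hh : Heavy x i 0 <;> simp [heavySum, hh]
  | succ q ih =>
    by_cases hh : Heavy x i (q + 1) <;> simp [heavySum, hh, ih, Finset.sum_add_distrib]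

theorem heavySum_mul (x : ℕ → ℕ) (c : ℕ) (f : ℕ → ℕ → ℕ) (q i : ℕ) :
    heavySum x (fun j s => f j s * c) q i = heavySum x f q i * c := by
  induction q generalizing i with
  | zero =>
    by_cases hh : Heavy x i 0 <;> simp [heavySum, hh]
  | succ q ih =>
    by_cases hh : Heavy x i (q + 1) <;> simp [heavySum, hh, ih, add_mul]

/-- The number of maximal heavy intervals of length `2 ^ s` in `[i, i + 2 ^ q)`. -/
noncomputable def heavyCount (x : ℕ → ℕ) (q i s : ℕ) : ℕ :=
  heavySum x (fun _ s' => if s' = s then 1 else 0) q i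

theorem heavySum_eq_sum_heavyCount (x : ℕ → ℕ) (g : ℕ → ℕ) (q i : ℕ) :
    heavySum x (fun _ s => g s) q i = ∑ s ∈ Finset.range (q + 1), heavyCount x q i s * g s := by
  simp only [heavyCount, ← heavySum_mul]
  rw [← heavySum_sum]
  refine heavySum_congr fun j s hs => ?_
  simp [Nat.lt_succ_of_le hs]

/-- An interval with half its mass average has a constant fraction covered by heavy intervals. -/
theorem two_pow_le_heavySum {x : ℕ → ℕ} {q i : ℕ} (h : 2 ^ q ≤ 2 * blockSum x i (2 ^ q)) :
    2 ^ q ≤ 32 * heavySum x (fun _ s => 2 ^ s) q i := by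
  -- All mass lies in heavy intervals, since a singleton with positive mass is heavy. A maximal
  -- heavy interval below a non-heavy one has a non-heavy parent, so its mass is at most `8 * 2 =
  -- 16` times its length.
  have key : ∀ q i, ¬ Heavy x i q →
      blockSum x i (2 ^ q) ≤ 16 * heavySum x (fun _ s => 2 ^ s) q i := by
    intro q
    induction q with
    | zero =>
      intro i hi
      have : blockSum x i 1 = 0 := by
        by_contra h0
        exact hi (Or.inl ⟨rfl, by omega⟩)
      simp [this]
    | succ q ih =>
      intro i hi
      have h2 : 2 ^ (q + 1) = 2 ^ q + 2 ^ q := by ring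
      have hlt : blockSum x i (2 ^ (q + 1)) < 16 * 2 ^ q := by
        by_contra h0
        exact hi (Or.inr (by omega))
      have child : ∀ j, blockSum x j (2 ^ q) ≤ blockSum x i (2 ^ (q + 1)) →
          blockSum x j (2 ^ q) ≤ 16 * heavySum x (fun _ s => 2 ^ s) q j := by
        intro j hj
        by_cases hh : Heavy x j q
        · rw [heavySum_of_heavy _ hh]
          omega
        · exact ih j hh
      have e := blockSum_add x i (2 ^ q) (2 ^ q)
      rw [← h2] at e
      have c1 := child i (by omega)
      have c2 := child (i + 2 ^ q) (by omega)
      rw [heavySum_succ_of_not _ hi]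
      omega
  by_cases hh : Heavy x i q
  · rw [heavySum_of_heavy _ hh]
    omega
  · have := key q i hh
    omega

/-- A heavy interval whose shift by `e - c` carries enough mass of `y` lets the common
subsequence through the two blocks grow. -/
theorem hasCommonSub_two_pow_add_heavySum {α : Type*} (a b : α) (x y : ℕ → ℕ) {c e q i : ℕ}
    (hc : c ≤ i) :
    HasCommonSub (2 ^ q + heavySum x
        (fun j s => if 2 * 2 ^ s ≤ blockSum y (j + e - c) (2 ^ s) + 1 then 2 ^ s else 0) q i)
      (blockWord a b x i (2 ^ q)) (blockWord a b y (i + e - c) (2 ^ q)) := by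
  have heavy : ∀ q i, Heavy x i q → HasCommonSub (2 ^ q + heavySum x
        (fun j s => if 2 * 2 ^ s ≤ blockSum y (j + e - c) (2 ^ s) + 1 then 2 ^ s else 0) q i)
      (blockWord a b x i (2 ^ q)) (blockWord a b y (i + e - c) (2 ^ q)) := by
    intro q i hh
    rw [heavySum_of_heavy _ hh]
    split_ifs with hy
    · refine (hasCommonSub_blockWord_snd a b x y i (i + e - c) (Nat.two_pow_pos q)).mono ?_
        (List.Sublist.refl _) (List.Sublist.refl _)
      -- Matching `b`'s here yields `2 * 2 ^ q` letters in place of `2 ^ q` letters `a`. For a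
      -- singleton of mass one the final `a` supplies the missing letter.
      have hx : 2 * 2 ^ q ≤ blockSum x i (2 ^ q) + 1 := by
        rcases hh with ⟨rfl, h⟩ | h
        · simpa using h
        · omega
      omega
    · simpa using hasCommonSub_blockWord_fst a b x y i (i + e - c) (2 ^ q) (2 ^ q)
  induction q generalizing i with
  | zero =>
    by_cases hh : Heavy x i 0
    · exact heavy 0 i hh
    · rw [heavySum_zero_of_not _ hh]
      exact (hasCommonSub_blockWord_fst a b x y i (i + e - c) (2 ^ 0) (2 ^ 0)).mono (by simp)
        (List.Sublist.refl _) (List.Sublist.refl _)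
  | succ q ih =>
    by_cases hh : Heavy x i (q + 1)
    · exact heavy _ i hh
    · have h2 : 2 ^ (q + 1) = 2 ^ q + 2 ^ q := by ring
      rw [heavySum_succ_of_not _ hh, h2, blockWord_add, blockWord_add]
      have h1 := ih hc
      have h3 := ih (hc.trans (Nat.le_add_right i (2 ^ q)))
      rw [show i + 2 ^ q + e - c = i + e - c + 2 ^ q by have := Nat.two_pow_pos q; omega] at h3
      exact (h1.append h3).mono (by omega) (List.Sublist.refl _) (List.Sublist.refl _)

end DyadicIntervals

/-! ### Double counting of gains over shifts. -/

section Hits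

/-- The window of length `2 ^ s` around the position `v` carries a mass of `y` that makes up for
a heavy interval of the same length. -/
def Hit (y : ℕ → ℕ) (s v : ℕ) : Prop :=
  2 * 2 ^ s ≤ blockSum y (v + 1 - 2 ^ (s - 1)) (2 ^ s) + 1

open Classical in
/-- The number of hits in `[i, i + n)`. -/
noncomputable def hitCount (y : ℕ → ℕ) (s i n : ℕ) : ℕ :=
  ((Finset.Ico i (i + n)).filter (Hit y s)).card

theorem hitCount_add (y : ℕ → ℕ) (s i n k : ℕ) :
    hitCount y s i (n + k) = hitCount y s i n + hitCount y s (i + n) k := by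
  classical
  unfold hitCount
  rw [← Finset.Ico_union_Ico_eq_Ico (show i ≤ i + n by omega) (show i + n ≤ i + (n + k) by omega),
    Finset.filter_union, Finset.card_union_of_disjoint, add_assoc]
  exact Finset.disjoint_filter_filter (Finset.Ico_disjoint_Ico_consecutive _ _ _)

theorem le_hitCount {y : ℕ → ℕ} {s i j n : ℕ} (h1 : i ≤ j) (h2 : j + 2 ^ (s - 1) ≤ i + n)
    (h : ∀ v, j ≤ v → v < j + 2 ^ (s - 1) → Hit y s v) : 2 ^ (s - 1) ≤ hitCount y s i n := by
  classical
  calc 2 ^ (s - 1) = (Finset.Ico j (j + 2 ^ (s - 1))).card := by simp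
    _ ≤ _ := Finset.card_le_card fun v hv => by
        rw [Finset.mem_Ico] at hv
        rw [Finset.mem_filter, Finset.mem_Ico]
        exact ⟨⟨by omega, by omega⟩, h v hv.1 hv.2⟩

/-- One half of an interval is at least as dense as the whole. -/
theorem exists_subinterval {y : ℕ → ℕ} {p q i : ℕ} (hpq : p ≤ q)
    (h : 8 * 2 ^ q ≤ blockSum y i (2 ^ q)) :
    ∃ j, i ≤ j ∧ j + 2 ^ p ≤ i + 2 ^ q ∧ 8 * 2 ^ p ≤ blockSum y j (2 ^ p) := by
  induction q generalizing i with
  | zero =>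
    obtain rfl : p = 0 := by omega
    exact ⟨i, le_rfl, le_rfl, h⟩
  | succ q ih =>
    rcases hpq.eq_or_lt with rfl | hlt
    · exact ⟨i, le_rfl, le_rfl, h⟩
    have h2 : 2 ^ (q + 1) = 2 ^ q + 2 ^ q := by ring
    rw [h2, blockSum_add] at h
    rcases le_total (8 * 2 ^ q) (blockSum y i (2 ^ q)) with hl | hl
    · obtain ⟨j, a1, a2, a3⟩ := ih (by omega) hl
      exact ⟨j, a1, by omega, a3⟩
    · obtain ⟨j, a1, a2, a3⟩ := ih (i := i + 2 ^ q) (by omega) (by omega)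
      exact ⟨j, by omega, by omega, a3⟩

theorem two_pow_le_hitCount {y : ℕ → ℕ} {s q i : ℕ} (hs : s ≤ q) (h : Heavy y i q) :
    2 ^ (s - 1) ≤ hitCount y s i (2 ^ q) := by
  obtain ⟨j, h1, h2, h3⟩ : ∃ j, i ≤ j ∧ j + 2 ^ (s - 1) ≤ i + 2 ^ q ∧
      2 * 2 ^ s ≤ blockSum y j (2 ^ (s - 1)) + 1 := by
    rcases h with ⟨rfl, h⟩ | h
    · obtain rfl : s = 0 := by omega
      exact ⟨i, le_rfl, le_rfl, by simpa using h⟩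
    · obtain ⟨j, h1, h2, h3⟩ := exists_subinterval (p := s - 1) (by omega) h
      refine ⟨j, h1, h2, ?_⟩
      cases s with
      | zero => simp at h3 ⊢; omega
      | succ s =>
        have : 2 ^ (s + 1) = 2 ^ s + 2 ^ s := by ring
        simp at h3 ⊢
        omega
  -- Every window around such a `v` contains the dense subinterval of length `2 ^ (s - 1)`. For `s =
  -- 0` the truncated exponent makes both a single point.
  refine le_hitCount h1 h2 fun v hv1 hv2 => h3.trans (add_le_add_left ?_ 1)
  have : 2 * 2 ^ (s - 1) ≤ 2 ^ s + 1 := by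
    cases s with
    | zero => simp
    | succ s =>
      have : 2 ^ (s + 1) = 2 ^ s + 2 ^ s := by ring
      simp
      omega
  exact blockSum_le_blockSum y (by omega) (by omega)

theorem mul_heavySum_le_hitCount (y : ℕ → ℕ) (s q i : ℕ) :
    2 ^ (s - 1) * heavySum y (fun _ s' => if s ≤ s' then 1 else 0) q i ≤
      hitCount y s i (2 ^ q) := by
  have heavy : ∀ q i, Heavy y i q →
      2 ^ (s - 1) * heavySum y (fun _ s' => if s ≤ s' then 1 else 0) q i ≤
        hitCount y s i (2 ^ q) := by
    intro q i hh
    rw [heavySum_of_heavy _ hh]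
    split_ifs with hs
    · simpa using two_pow_le_hitCount hs hh
    · simp
  induction q generalizing i with
  | zero =>
    by_cases hh : Heavy y i 0
    · exact heavy 0 i hh
    · simp [heavySum_zero_of_not _ hh]
  | succ q ih =>
    by_cases hh : Heavy y i (q + 1)
    · exact heavy _ i hh
    · rw [heavySum_succ_of_not _ hh, show 2 ^ (q + 1) = 2 ^ q + 2 ^ q by ring, hitCount_add,
        mul_add]
      exact add_le_add (ih i) (ih _)

open Classical in
/-- Each hit in the interval is met by a shift of each of its subintervals. -/
theorem hitCount_le_card_shifts {y : ℕ → ℕ} {s q i j : ℕ} (hs : s ≤ q) (hi : 2 * 2 ^ q ≤ i)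
    (hj : i ≤ j) (hj' : j < i + 2 ^ q) :
    hitCount y s i (2 ^ q) ≤ ((Finset.range (4 * 2 ^ q + 1)).filter fun e =>
      2 * 2 ^ s ≤ blockSum y (j + e - 2 * 2 ^ q) (2 ^ s) + 1).card := by
  have hle : 2 ^ (s - 1) ≤ 2 ^ q := Nat.pow_le_pow_right (by norm_num) (by omega)
  have hpos := Nat.two_pow_pos (s - 1)
  -- The shift `e` that carries `j` to the start of the window around `v`.
  refine Finset.card_le_card_of_injOn (fun v => v + 1 - 2 ^ (s - 1) + 2 * 2 ^ q - j) ?_ ?_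
  · intro v hv
    simp only [Finset.coe_filter, Finset.mem_Ico, Set.mem_ofPred_eq] at hv
    simp only [Finset.coe_filter, Finset.mem_range, Set.mem_ofPred_eq]
    refine ⟨by omega, ?_⟩
    have := hv.2
    rw [Hit] at this
    rwa [show j + (v + 1 - 2 ^ (s - 1) + 2 * 2 ^ q - j) - 2 * 2 ^ q = v + 1 - 2 ^ (s - 1) by omega]
  · intro v hv v' hv' h
    simp only [Finset.coe_filter, Finset.mem_Ico, Set.mem_ofPred_eq] at hv hv'
    simp only at h
    omega

/-- The gain of the pair `(x, y)` on the interval `[i, i + 2 ^ q)`, added up over the shifts. -/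
noncomputable def shiftGain (x y : ℕ → ℕ) (q i e : ℕ) : ℕ :=
  heavySum x (fun j s => if 2 * 2 ^ s ≤ blockSum y (j + e - 2 * 2 ^ q) (2 ^ s) + 1
    then 2 ^ s else 0) q i

/-- Each maximal heavy interval of `y` of length at least `2 ^ s` contains `2 ^ (s - 1)` hits. Each
hit is a shift at which a given heavy interval of `x` of length `2 ^ s` gains `2 ^ s`. -/
theorem sum_le_sum_shiftGain (x y : ℕ → ℕ) {q i : ℕ} (hi : 2 * 2 ^ q ≤ i) :
    ∑ s ∈ Finset.range (q + 1), ∑ s' ∈ Finset.range (q + 1),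
        heavyCount x q i s * heavyCount y q i s' * (if s ≤ s' then 2 ^ s * 2 ^ s else 0) ≤
      2 * ∑ e ∈ Finset.range (4 * 2 ^ q + 1), shiftGain x y q i e := by
  classical
  have h1 : heavySum x (fun _ s => 2 ^ s * hitCount y s i (2 ^ q)) q i ≤
      ∑ e ∈ Finset.range (4 * 2 ^ q + 1), shiftGain x y q i e := by
    simp only [shiftGain]
    rw [← heavySum_sum]
    refine heavySum_mono fun j s hs hj hj' => ?_
    rw [← Finset.sum_filter, Finset.sum_const, smul_eq_mul, mul_comm]
    exact Nat.mul_le_mul_right _ (hitCount_le_card_shifts hs hi hj hj')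
  rw [heavySum_eq_sum_heavyCount x (fun s => 2 ^ s * hitCount y s i (2 ^ q))] at h1
  refine le_trans ?_ (Nat.mul_le_mul_left 2 h1)
  rw [Finset.mul_sum]
  refine Finset.sum_le_sum fun s _ => ?_
  have h2 := mul_heavySum_le_hitCount y s q i
  rw [heavySum_eq_sum_heavyCount y (fun s' => if s ≤ s' then 1 else 0)] at h2
  have h3 : 2 ^ s ≤ 2 * 2 ^ (s - 1) := by
    cases s with
    | zero => simp
    | succ s => simp [pow_succ, mul_comm]
  calc _ = heavyCount x q i s * 2 ^ s * (2 ^ s * ∑ s' ∈ Finset.range (q + 1),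
          heavyCount y q i s' * if s ≤ s' then 1 else 0) := by
        rw [Finset.mul_sum, Finset.mul_sum]
        refine Finset.sum_congr rfl fun s' _ => ?_
        split_ifs <;> ring
    _ ≤ heavyCount x q i s * 2 ^ s * (2 * 2 ^ (s - 1) * ∑ s' ∈ Finset.range (q + 1),
          heavyCount y q i s' * if s ≤ s' then 1 else 0) := by gcongr
    _ ≤ heavyCount x q i s * 2 ^ s * (2 * hitCount y s i (2 ^ q)) := by
        rw [mul_assoc 2]; gcongr
    _ = _ := by ring

end Hits

/-! ### Lower bounds for the LCS of two words with given profiles. -/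

section Profiles

variable {α : Type*} {a b : α} {m : ℕ} {u v : List α} {x y : ℕ → ℕ}

/-- The word `w` contains `m` letters `a` and `m` letters `b`, and the numbers of letters `b`
between the letters `a` are `x 0, …, x m`. -/
def HasProfile (a b : α) (m : ℕ) (w : List α) (x : ℕ → ℕ) : Prop :=
  (blockWord a b x 0 m ++ List.replicate (x m) b).Sublist w ∧ blockSum x 0 (m + 1) = m

theorem exists_hasProfile [DecidableEq α] (hab : a ≠ b) (ha : u.count a = m)
    (hb : u.count b = m) : ∃ x, HasProfile a b m u x := by
  obtain ⟨x, hx, hs⟩ := exists_blockWord_sublist hab u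
  rw [ha] at hx hs
  exact ⟨x, hx, hs.trans hb⟩

theorem HasProfile.sublist_append (hu : HasProfile a b m u x) {τ : ℕ} (hτ : τ ≤ m) :
    (blockWord a b x 0 τ ++ (blockWord a b x τ (m - τ) ++ List.replicate (x m) b)).Sublist u := by
  have h := hu.1
  rw [← Nat.add_sub_cancel' hτ, blockWord_add, zero_add, Nat.add_sub_cancel' hτ] at h
  simpa [List.append_assoc] using h

theorem HasProfile.blockSum_add_eq (hu : HasProfile a b m u x) {τ : ℕ} (hτ : τ ≤ m) :
    blockSum x 0 τ + (blockSum x τ (m - τ) + x m) = m := by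
  have h := hu.2
  have h1 := blockSum_add x 0 τ (m - τ)
  have h2 := blockSum_add x 0 m 1
  rw [Nat.add_sub_cancel' hτ] at h1
  simp only [zero_add, blockSum, Finset.sum_range_one, add_zero] at h h1 h2 ⊢
  omega

theorem HasProfile.add_min_sub_le_lcs (hu : HasProfile a b m u x) (hv : HasProfile a b m v y)
    {τ : ℕ} (hτ : τ ≤ m) :
    τ + min (m - blockSum x 0 τ) (m - blockSum y 0 τ) ≤ lcs u v := by
  have key : ∀ {u x}, HasProfile a b m u x → (List.replicate (m - blockSum x 0 τ) b).Sublist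
      (blockWord a b x τ (m - τ) ++ List.replicate (x m) b) := by
    intro u x hu
    have h := hu.blockSum_add_eq hτ
    rw [show m - blockSum x 0 τ = blockSum x τ (m - τ) + x m by omega, List.replicate_add]
    exact (replicate_snd_sublist_blockWord a b x τ (m - τ)).append (List.Sublist.refl _)
  exact (((hasCommonSub_blockWord_fst a b x y 0 0 τ τ).append
    (hasCommonSub_replicate (key hu) (key hv))).mono (by simp)
    (hu.sublist_append hτ) (hv.sublist_append hτ)).le_lcs

theorem HasProfile.min_add_sub_le_lcs (hu : HasProfile a b m u x) (hv : HasProfile a b m v y)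
    {τ : ℕ} (hτ : τ ≤ m) :
    min (blockSum x 0 τ) (blockSum y 0 τ) + min τ 1 + (m - τ) ≤ lcs u v := by
  have h1 : HasCommonSub (min (blockSum x 0 τ) (blockSum y 0 τ) + min τ 1)
      (blockWord a b x 0 τ) (blockWord a b y 0 τ) := by
    rcases Nat.eq_zero_or_pos τ with rfl | h
    · exact (hasCommonSub_blockWord_fst a b x y 0 0 0 0).mono (by simp [blockSum])
        (List.Sublist.refl _) (List.Sublist.refl _)
    · exact (hasCommonSub_blockWord_snd a b x y 0 0 h).mono (by omega)
        (List.Sublist.refl _) (List.Sublist.refl _)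
  have h2 := (hasCommonSub_blockWord_fst a b x y τ τ (m - τ) (m - τ)).mono (min_self _).ge
    (List.sublist_append_left _ (List.replicate (x m) b))
    (List.sublist_append_left _ (List.replicate (y m) b))
  exact ((h1.append h2).mono le_rfl (hu.sublist_append hτ) (hv.sublist_append hτ)).le_lcs

theorem hasCommonSub_blockWord_shift (a b : α) (x y : ℕ → ℕ) (q e N : ℕ) :
    HasCommonSub
      (N * 2 ^ q + ∑ l ∈ Finset.range N, shiftGain x y q (2 * 2 ^ q + l * 2 ^ q) e)
      (blockWord a b x (2 * 2 ^ q) (N * 2 ^ q)) (blockWord a b y e (N * 2 ^ q)) := by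
  induction N with
  | zero => exact ⟨[], by simp, by simp, by simp⟩
  | succ N ih =>
    have h := hasCommonSub_two_pow_add_heavySum a b x y (c := 2 * 2 ^ q) (e := e) (q := q)
      (i := 2 * 2 ^ q + N * 2 ^ q) (by omega)
    rw [show 2 * 2 ^ q + N * 2 ^ q + e - 2 * 2 ^ q = e + N * 2 ^ q by omega] at h
    rw [add_mul, one_mul, blockWord_add, blockWord_add, Finset.sum_range_succ]
    exact (ih.append h).mono (by rw [shiftGain]; omega) (List.Sublist.refl _) (List.Sublist.refl _)

/-- Block `2 * 2 ^ q` of `x` is aligned with block `e` of `y`, and only `a`'s are matched before and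
after the `N` intervals. The misalignment costs `|2 * 2 ^ q - e|` letters. -/
theorem HasProfile.add_sum_shiftGain_le_lcs (hu : HasProfile a b m u x)
    (hv : HasProfile a b m v y) {q e N : ℕ} (he : e ≤ 4 * 2 ^ q) (hN : (N + 4) * 2 ^ q ≤ m) :
    m + ∑ l ∈ Finset.range N, shiftGain x y q (2 * 2 ^ q + l * 2 ^ q) e ≤
      lcs u v + 2 * 2 ^ q := by
  rw [add_mul] at hN
  have split : ∀ (z : ℕ → ℕ) (j : ℕ), j ≤ 4 * 2 ^ q → blockWord a b z 0 m =
      blockWord a b z 0 j ++ (blockWord a b z j (N * 2 ^ q) ++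
        blockWord a b z (j + N * 2 ^ q) (m - N * 2 ^ q - j)) := by
    intro z j hj
    have h := blockWord_add a b z 0 j (N * 2 ^ q + (m - N * 2 ^ q - j))
    rw [zero_add] at h
    rw [← blockWord_add, ← h]
    congr 1
    omega
  have h := ((hasCommonSub_blockWord_fst a b x y 0 0 (2 * 2 ^ q) e).append
    ((hasCommonSub_blockWord_shift a b x y q e N).append
    (hasCommonSub_blockWord_fst a b x y (2 * 2 ^ q + N * 2 ^ q) (e + N * 2 ^ q)
      (m - N * 2 ^ q - 2 * 2 ^ q) (m - N * 2 ^ q - e))))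
  rw [← split x _ (by omega), ← split y _ he] at h
  have := (h.mono le_rfl ((List.sublist_append_left _ _).trans hu.1)
    ((List.sublist_append_left _ _).trans hv.1)).le_lcs
  omega

end Profiles

/-! ### Pigeonhole over scales, averaging over shifts and pairs. -/

section Averaging

/-- For scales in `A` the product of two lengths is at most `Λ` times the square of the smaller. The
two orders of `x` and `y` cover the two cases of which interval is smaller. -/
theorem mul_le_of_classes {x y : ℕ → ℕ} {q i Λ : ℕ} (hi : 2 * 2 ^ q ≤ i) {A : Finset ℕ}
    (hA : A ⊆ Finset.range (q + 1))
    (hΛ : ∀ s ∈ A, ∀ s' ∈ A, 2 ^ s' ≤ Λ * 2 ^ s) :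
    (∑ s ∈ A, heavyCount x q i s * 2 ^ s) * (∑ s ∈ A, heavyCount y q i s * 2 ^ s) ≤
      2 * Λ * (∑ e ∈ Finset.range (4 * 2 ^ q + 1), shiftGain x y q i e +
        ∑ e ∈ Finset.range (4 * 2 ^ q + 1), shiftGain y x q i e) := by
  set F : ℕ → ℕ → ℕ := fun s s' =>
    heavyCount x q i s * heavyCount y q i s' * (if s ≤ s' then 2 ^ s * 2 ^ s else 0)
  set G : ℕ → ℕ → ℕ := fun s s' =>
    heavyCount y q i s * heavyCount x q i s' * (if s ≤ s' then 2 ^ s * 2 ^ s else 0)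
  have mono : ∀ f : ℕ → ℕ → ℕ, ∑ s ∈ A, ∑ s' ∈ A, f s s' ≤
      ∑ s ∈ Finset.range (q + 1), ∑ s' ∈ Finset.range (q + 1), f s s' := fun f =>
    (Finset.sum_le_sum fun s _ => Finset.sum_le_sum_of_subset hA).trans
      (Finset.sum_le_sum_of_subset hA)
  have hF := (mono F).trans (sum_le_sum_shiftGain x y hi)
  have hG := (mono G).trans (sum_le_sum_shiftGain y x hi)
  have hFG : (∑ s ∈ A, heavyCount x q i s * 2 ^ s) * (∑ s ∈ A, heavyCount y q i s * 2 ^ s) ≤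
      Λ * (∑ s ∈ A, ∑ s' ∈ A, F s s' + ∑ s ∈ A, ∑ s' ∈ A, G s s') := by
    rw [Finset.sum_comm (f := G), ← Finset.sum_add_distrib, Finset.sum_mul_sum, Finset.mul_sum]
    refine Finset.sum_le_sum fun s hs => ?_
    rw [← Finset.sum_add_distrib, Finset.mul_sum]
    refine Finset.sum_le_sum fun s' hs' => ?_
    rcases le_total s s' with h | h
    · calc _ = heavyCount x q i s * heavyCount y q i s' * 2 ^ s * 2 ^ s' := by ring
        _ ≤ heavyCount x q i s * heavyCount y q i s' * 2 ^ s * (Λ * 2 ^ s) :=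
          Nat.mul_le_mul_left _ (hΛ s hs s' hs')
        _ = Λ * F s s' := by simp only [F, if_pos h]; ring
        _ ≤ _ := Nat.mul_le_mul_left _ (Nat.le_add_right _ _)
    · calc _ = heavyCount x q i s * heavyCount y q i s' * 2 ^ s' * 2 ^ s := by ring
        _ ≤ heavyCount x q i s * heavyCount y q i s' * 2 ^ s' * (Λ * 2 ^ s') :=
          Nat.mul_le_mul_left _ (hΛ s' hs' s hs)
        _ = Λ * G s' s := by simp only [G, if_pos h]; ring
        _ ≤ _ := Nat.mul_le_mul_left _ (Nat.le_add_left _ _)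
  calc _ ≤ _ := hFG
    _ ≤ Λ * (2 * _ + 2 * _) := Nat.mul_le_mul_left _ (add_le_add hF hG)
    _ = _ := by ring

theorem exists_class {x : ℕ → ℕ} {q i p D : ℕ} (hp : 0 < p) (hD : q < D * p)
    (h : 2 ^ q ≤ 2 * blockSum x i (2 ^ q)) :
    ∃ j ∈ Finset.range p, 2 ^ q ≤ 32 * p *
      ∑ s ∈ Finset.range (q + 1) with s / D = j, heavyCount x q i s * 2 ^ s := by
  by_contra! hc
  have h1 := two_pow_le_heavySum h
  rw [heavySum_eq_sum_heavyCount x (fun s => 2 ^ s),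
    ← Finset.sum_fiberwise_of_maps_to (s := Finset.range (q + 1)) (t := Finset.range p)
      (g := fun s => s / D)] at h1
  · have h2 := Finset.sum_lt_sum_of_nonempty (s := Finset.range p) ⟨0, by simpa⟩ hc
    rw [← Finset.mul_sum, Finset.sum_const, Finset.card_range, smul_eq_mul] at h2
    have h3 := Nat.mul_le_mul_left p h1
    have h4 : ∀ z : ℕ, 32 * p * z = p * (32 * z) := fun z => by ring
    rw [h4] at h2
    omega
  · intro s hs
    rw [Finset.mem_range] at hs ⊢
    exact Nat.div_lt_of_lt_mul (by omega)

theorem two_pow_mul_two_pow_le_sum_shiftGain {ι : Type*} [DecidableEq ι] {x : ι → ℕ → ℕ}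
    {q i p : ℕ} (hp : 0 < p) (hi : 2 * 2 ^ q ≤ i) {I R : Finset ι} (hRI : R ⊆ I)
    (hR : p < R.card) (h : ∀ X ∈ R, 2 ^ q ≤ 2 * blockSum (x X) i (2 ^ q)) :
    2 ^ q * 2 ^ q ≤ 2048 * p ^ 2 * 2 ^ (q / p) *
      ∑ P ∈ I.offDiag, ∑ e ∈ Finset.range (4 * 2 ^ q + 1), shiftGain (x P.1) (x P.2) q i e := by
  have hD : q < (q / p + 1) * p := by
    rw [mul_comm]; exact Nat.lt_mul_div_succ q hp
  choose! j hj hj' using fun X hX => exists_class hp hD (h X hX)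
  obtain ⟨X, hX, Y, hY, hXY, hjXY⟩ :=
    Finset.exists_ne_map_eq_of_card_lt_of_maps_to (by simpa using hR) hj
  have h1 := hj' X hX
  have h2 := hj' Y hY
  rw [← hjXY] at h2
  have h3 := mul_le_of_classes (x := x X) (y := x Y) (Λ := 2 ^ (q / p)) hi
    (A := {s ∈ Finset.range (q + 1) | s / (q / p + 1) = j X}) (Finset.filter_subset _ _) (by
      intro s hs s' hs'
      rw [← pow_add]
      refine Nat.pow_le_pow_right (by norm_num) ?_
      have e1 := (Finset.mem_filter.1 hs).2
      have e2 := (Finset.mem_filter.1 hs').2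
      have m1 := Nat.div_add_mod s (q / p + 1)
      have m2 := Nat.div_add_mod s' (q / p + 1)
      have m3 := Nat.mod_lt s' (Nat.add_one_pos (q / p))
      rw [e1] at m1
      rw [e2] at m2
      omega)
  have h4 : ∑ e ∈ Finset.range (4 * 2 ^ q + 1), shiftGain (x X) (x Y) q i e +
      ∑ e ∈ Finset.range (4 * 2 ^ q + 1), shiftGain (x Y) (x X) q i e ≤
      ∑ P ∈ I.offDiag, ∑ e ∈ Finset.range (4 * 2 ^ q + 1),
        shiftGain (x P.1) (x P.2) q i e := by
    rw [← Finset.sum_pair (f := fun P : ι × ι => ∑ e ∈ Finset.range (4 * 2 ^ q + 1),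
      shiftGain (x P.1) (x P.2) q i e) (a := (X, Y)) (b := (Y, X)) (by simp [hXY])]
    refine Finset.sum_le_sum_of_subset fun P hP => ?_
    rw [Finset.mem_insert, Finset.mem_singleton] at hP
    rw [Finset.mem_offDiag]
    rcases hP with rfl | rfl
    · exact ⟨hRI hX, hRI hY, hXY⟩
    · exact ⟨hRI hY, hRI hX, hXY.symm⟩
  calc _ ≤ _ := Nat.mul_le_mul h1 h2
    _ = 1024 * p ^ 2 * (_ * _) := by ring
    _ ≤ 1024 * p ^ 2 * (2 * 2 ^ (q / p) * _) := Nat.mul_le_mul_left _ (h3.trans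
        (Nat.mul_le_mul_left _ h4))
    _ = _ := by ring

variable {α : Type*} {a b : α} {m : ℕ}

theorem card_le_card_filter_add_two {ι : Type*} {I : Finset ι} {W : ι → List α} {x : ι → ℕ → ℕ}
    (hW : ∀ X ∈ I, HasProfile a b m (W X) (x X)) {d ℓ i : ℕ} (hd : 4 * d ≤ ℓ) (hi : i + ℓ ≤ m)
    (hlcs : ∀ X ∈ I, ∀ Y ∈ I, X ≠ Y → lcs (W X) (W Y) < m + d) :
    I.card ≤ {X ∈ I | ℓ ≤ 2 * blockSum (x X) i ℓ}.card + 2 := by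
  classical
  -- Two words with `d` surplus `b`'s before `i` would gain `d` by matching `b`'s up to `i` and
  -- `a`'s afterwards. `hQ` is the mirror image: `a`'s first, then `b`'s. A word in neither set has
  -- mass above `ℓ - 2 * d ≥ ℓ / 2` on the interval.
  have hP : {X ∈ I | i + d ≤ blockSum (x X) 0 i}.card ≤ 1 := by
    refine Finset.card_le_one.2 fun X hX Y hY => ?_
    rw [Finset.mem_filter] at hX hY
    by_contra hne
    have h1 := (hW X hX.1).min_add_sub_le_lcs (hW Y hY.1) (show i ≤ m by omega)
    have h2 := hlcs X hX.1 Y hY.1 hne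
    omega
  have hQ : {X ∈ I | blockSum (x X) 0 (i + ℓ) + d ≤ i + ℓ}.card ≤ 1 := by
    refine Finset.card_le_one.2 fun X hX Y hY => ?_
    rw [Finset.mem_filter] at hX hY
    by_contra hne
    have h1 := (hW X hX.1).add_min_sub_le_lcs (hW Y hY.1) hi
    have h2 := hlcs X hX.1 Y hY.1 hne
    omega
  have hsub : I ⊆ {X ∈ I | ℓ ≤ 2 * blockSum (x X) i ℓ} ∪
      ({X ∈ I | i + d ≤ blockSum (x X) 0 i} ∪
        {X ∈ I | blockSum (x X) 0 (i + ℓ) + d ≤ i + ℓ}) := by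
    intro X hX
    simp only [Finset.mem_union, Finset.mem_filter, hX, true_and]
    have := blockSum_add (x X) 0 i ℓ
    rw [zero_add] at this
    omega
  have h1 := Finset.card_le_card hsub
  have h2 := Finset.card_union_le {X ∈ I | ℓ ≤ 2 * blockSum (x X) i ℓ}
    ({X ∈ I | i + d ≤ blockSum (x X) 0 i} ∪ {X ∈ I | blockSum (x X) 0 (i + ℓ) + d ≤ i + ℓ})
  have h3 := Finset.card_union_le {X ∈ I | i + d ≤ blockSum (x X) 0 i}
    {X ∈ I | blockSum (x X) 0 (i + ℓ) + d ≤ i + ℓ}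
  omega

/-- If all pairs of words have a short longest common subsequence, the length of the words is
bounded. -/
theorem mul_two_pow_le_of_lcs_lt [DecidableEq α] (hab : a ≠ b) {p d q N : ℕ} (hp : 0 < p)
    {W : Fin (p + 3) → List α} (ha : ∀ X, (W X).count a = m) (hb : ∀ X, (W X).count b = m)
    (hd : 4 * d ≤ 2 ^ q) (hN : (N + 4) * 2 ^ q ≤ m)
    (hlcs : ∀ X Y, X ≠ Y → lcs (W X) (W Y) < m + d) :
    N * (2 ^ q * 2 ^ q) ≤ 2048 * p ^ 2 * 2 ^ (q / p) *
      ((p + 3) ^ 2 * ((4 * 2 ^ q + 1) * (2 * 2 ^ q + d))) := by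
  choose x hx using fun X => exists_hasProfile hab (ha X) (hb X)
  have hloc : ∀ l ∈ Finset.range N, 2 ^ q * 2 ^ q ≤ 2048 * p ^ 2 * 2 ^ (q / p) *
      ∑ P ∈ (Finset.univ : Finset (Fin (p + 3))).offDiag,
        ∑ e ∈ Finset.range (4 * 2 ^ q + 1),
          shiftGain (x P.1) (x P.2) q (2 * 2 ^ q + l * 2 ^ q) e := by
    intro l hl
    rw [Finset.mem_range] at hl
    have hi : 2 * 2 ^ q + l * 2 ^ q + 2 ^ q ≤ m := by nlinarith
    have hc := card_le_card_filter_add_two (I := Finset.univ) (fun X _ => hx X) hd hi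
      (fun X _ Y _ => hlcs X Y)
    rw [Finset.card_univ, Fintype.card_fin] at hc
    exact two_pow_mul_two_pow_le_sum_shiftGain hp (Nat.le_add_right _ _)
      (Finset.filter_subset _ _) (by omega) (fun X hX => (Finset.mem_filter.1 hX).2)
  have hsum := Finset.sum_le_sum hloc
  rw [Finset.sum_const, Finset.card_range, smul_eq_mul, ← Finset.mul_sum] at hsum
  refine hsum.trans (Nat.mul_le_mul_left _ ?_)
  rw [Finset.sum_comm]
  calc _ ≤ ∑ P ∈ (Finset.univ : Finset (Fin (p + 3))).offDiag,
        (4 * 2 ^ q + 1) * (2 * 2 ^ q + d) := by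
        refine Finset.sum_le_sum fun P hP => ?_
        rw [Finset.sum_comm]
        calc _ ≤ ∑ e ∈ Finset.range (4 * 2 ^ q + 1), (2 * 2 ^ q + d) := by
              refine Finset.sum_le_sum fun e he => ?_
              have h1 := (hx P.1).add_sum_shiftGain_le_lcs (hx P.2)
                (Nat.lt_succ_iff.1 (Finset.mem_range.1 he)) hN
              have h2 := hlcs P.1 P.2 (Finset.mem_offDiag.1 hP).2.2
              omega
          _ = _ := by simp
    _ ≤ _ := by
        rw [Finset.sum_const, smul_eq_mul, Finset.offDiag_card]
        refine Nat.mul_le_mul_right _ ?_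
        simp only [Finset.card_univ, Fintype.card_fin]
        exact (Nat.sub_le _ _).trans (by rw [sq])

end Averaging

/-! ### From the counting inequality to the power of `m`. -/

section Bounds

variable {α : Type*} [DecidableEq α] {a b : α} {m : ℕ}

theorem exists_lt_lcs_of_three (hab : a ≠ b) (hm : 0 < m) {W : Fin 3 → List α}
    (ha : ∀ X, (W X).count a = m) (hb : ∀ X, (W X).count b = m) :
    ∃ X Y, X ≠ Y ∧ m + 1 ≤ lcs (W X) (W Y) := by
  choose x hx using fun X => exists_hasProfile hab (ha X) (hb X)
  -- Two of the three words agree on whether they start with `b`. If neither does, match one `a` and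
  -- then all `b`'s; if both do, match one `b` and then all `a`'s.
  obtain ⟨X, Y, hXY, h⟩ := Fintype.exists_ne_map_eq_of_card_lt
    (fun X => decide (blockSum (x X) 0 1 = 0)) (by simp)
  refine ⟨X, Y, hXY, ?_⟩
  have h1 := (hx X).add_min_sub_le_lcs (hx Y) hm
  have h2 := (hx X).min_add_sub_le_lcs (hx Y) hm
  rw [decide_eq_decide] at h
  simp only [Nat.succ_eq_add_one, zero_add] at h1 h2
  omega

theorem lt_mul_of_lcs_lt (hab : a ≠ b) {p d : ℕ} (hp : 0 < p) (hd : 0 < d)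
    {W : Fin (p + 3) → List α} (ha : ∀ X, (W X).count a = m) (hb : ∀ X, (W X).count b = m)
    (hdm : 32 * d ≤ m) (hlcs : ∀ X Y, X ≠ Y → lcs (W X) (W Y) < m + d) :
    ∃ Λ : ℕ, Λ ^ p < 8 * d ∧ m < 983080 * (p + 1) ^ 4 * Λ * d := by
  -- The least scale with `4 * d ≤ 2 ^ q`, as localization requires; minimality gives `2 ^ q < 8 *
  -- d`.
  set q := Nat.clog 2 (4 * d) with hq
  have h1 : 4 * d ≤ 2 ^ q := Nat.le_pow_clog (by norm_num) _
  have h2 : 2 ^ q < 8 * d := by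
    have hq0 : q ≠ 0 := by
      intro h0
      rw [h0] at h1
      omega
    obtain ⟨s, hs⟩ := Nat.exists_eq_succ_of_ne_zero hq0
    have := Nat.pow_pred_clog_lt_self (b := 2) (by norm_num) (show 1 < 4 * d by omega)
    rw [← hq, hs] at this
    rw [hs, Nat.succ_eq_add_one, pow_succ]
    simp at this
    omega
  have hpos := Nat.two_pow_pos q
  refine ⟨2 ^ (q / p), ?_, ?_⟩
  · rw [← pow_mul]
    exact (Nat.pow_le_pow_right (by norm_num) (Nat.div_mul_le_self q p)).trans_lt h2
  set N := m / 2 ^ q - 4 with hN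
  have h4 : 4 ≤ m / 2 ^ q := (Nat.le_div_iff_mul_le hpos).2 (by omega)
  have hN4 : N + 4 = m / 2 ^ q := by omega
  have h3 := mul_two_pow_le_of_lcs_lt hab hp ha hb h1
    (by rw [hN4]; exact Nat.div_mul_le_self _ _) hlcs
  have h5 : m < (N + 5) * 2 ^ q := by
    rw [show N + 5 = m / 2 ^ q + 1 by omega, mul_comm]
    exact Nat.lt_mul_div_succ m hpos
  have hΛ := Nat.two_pow_pos (q / p)
  set Λ := 2 ^ (q / p)
  set ℓ := 2 ^ q
  have h6 : N ≤ 122880 * (p + 1) ^ 4 * Λ := by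
    refine Nat.le_of_mul_le_mul_right ?_ (Nat.mul_pos hpos hpos)
    calc _ ≤ _ := h3
      _ ≤ 2048 * p ^ 2 * Λ * ((p + 3) ^ 2 * ((5 * ℓ) * (3 * ℓ))) := by
          gcongr <;> omega
      _ = 30720 * (p * (p + 3)) ^ 2 * Λ * (ℓ * ℓ) := by ring
      _ ≤ 30720 * (2 * (p + 1) ^ 2) ^ 2 * Λ * (ℓ * ℓ) := by
          have : p * (p + 3) ≤ 2 * (p + 1) ^ 2 := by nlinarith
          gcongr
      _ = _ := by ring
  have h7 : 1 ≤ (p + 1) ^ 4 * Λ := Nat.mul_pos (by positivity) hΛ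
  calc m < (N + 5) * ℓ := h5
    _ ≤ (122880 * (p + 1) ^ 4 * Λ + 5 * ((p + 1) ^ 4 * Λ)) * (8 * d) :=
        Nat.mul_le_mul (by omega) h2.le
    _ = _ := by ring

theorem exists_add_rpow_le_lcs (hab : a ≠ b) {r : ℕ} (hr : 1 ≤ r) {W : Fin (r + 2) → List α}
    (ha : ∀ X, (W X).count a = m) (hb : ∀ X, (W X).count b = m)
    (hm : (10 * (r : ℝ)) ^ (9 * r) / 2 ≤ m) :
    ∃ X Y, X ≠ Y ∧ (m : ℝ) + 1 / 10 ^ 7 * ((r : ℝ) ^ (-9 : ℤ) * (m : ℝ) ^ (1 - 1 / (r : ℝ))) ≤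
      lcs (W X) (W Y) := by
  obtain ⟨p, rfl⟩ : ∃ p, r = p + 1 := ⟨r - 1, by omega⟩
  rcases Nat.eq_zero_or_pos p with rfl | hp
  · have hm0 : 0 < m := by
      rw [← Nat.cast_pos (α := ℝ)]
      refine lt_of_lt_of_le ?_ hm
      norm_num
    obtain ⟨X, Y, hXY, h⟩ := exists_lt_lcs_of_three hab hm0 ha hb
    refine ⟨X, Y, hXY, ?_⟩
    have h' : (m : ℝ) + 1 ≤ lcs (W X) (W Y) := by exact_mod_cast h
    norm_num
    linarith
  by_contra! hc
  set R : ℝ := ((p + 1 : ℕ) : ℝ) with hR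
  have hp1 : (1 : ℝ) ≤ p := by exact_mod_cast hp
  have hR1 : 2 ≤ R := by rw [hR]; push_cast; linarith
  -- With `m = μ ^ (p + 1)` and `m ^ (1 - 1 / R) = μ ^ p`, only natural powers remain.
  set μ : ℝ := (m : ℝ) ^ (1 / R) with hμ
  have hm0 : (0 : ℝ) ≤ m := Nat.cast_nonneg m
  have hμ0 : 0 ≤ μ := Real.rpow_nonneg hm0 _
  have hμp : (m : ℝ) ^ (1 - 1 / R) = μ ^ p := by
    rw [hμ, ← Real.rpow_natCast, ← Real.rpow_mul hm0]
    congr 1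
    have : (p : ℝ) = R - 1 := by rw [hR]; push_cast; ring
    rw [this]
    field_simp
  have hμm : μ ^ (p + 1) = m := by
    rw [hμ, one_div]
    exact Real.rpow_inv_natCast_pow hm0 (by omega)
  have hμR : (10 * R) ^ 9 / 2 ≤ μ := by
    refine le_of_pow_le_pow_left₀ (n := p + 1) (by omega) hμ0 ?_
    rw [hμm, div_pow, ← pow_mul]
    refine le_trans ?_ hm
    gcongr
    exact le_self_pow₀ (by norm_num) (by omega)
  have hR9 : 1 ≤ R ^ 9 := one_le_pow₀ (by linarith)
  rw [mul_pow] at hμR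
  have hμ1 : 1 ≤ μ := by linarith
  have hμM : μ ≤ μ ^ p := le_self_pow₀ hμ1 (by omega)
  rw [hμp] at hc
  set δ : ℝ := 1 / 10 ^ 7 * (R ^ (-9 : ℤ) * μ ^ p) with hδ
  have hδM : μ ^ p = 10 ^ 7 * (R ^ 9 * δ) := by
    rw [hδ, zpow_neg]
    have : R ^ (9 : ℤ) = R ^ 9 := by norm_cast
    rw [this]
    field_simp
  have hδ1 : 1 ≤ δ := by
    by_contra! h
    have : R ^ 9 * δ ≤ R ^ 9 * 1 := by gcongr
    linarith
  have hδd := Nat.le_ceil δ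
  -- The lower bound on `m` serves to make `δ ≥ 1`, so that rounding up at most doubles it.
  have hd2 : (⌈δ⌉₊ : ℝ) ≤ 2 * δ := by
    have := Nat.ceil_lt_add_one (show 0 ≤ δ by linarith)
    linarith
  have hdpos : 0 < ⌈δ⌉₊ := Nat.ceil_pos.2 (by linarith)
  set d := ⌈δ⌉₊
  have hR4 : R ^ 4 ≤ R ^ 9 := pow_le_pow_right₀ (by linarith) (by norm_num)
  have hR41 : 1 ≤ R ^ 4 := one_le_pow₀ (by linarith)
  have hM4 : 5000000 * (R ^ 4 * d) ≤ μ ^ p := by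
    rw [hδM]
    have : R ^ 4 * d ≤ R ^ 9 * (2 * δ) := by gcongr
    linarith
  have hd0 : (0 : ℝ) < d := by exact_mod_cast hdpos
  have hMd : 5000000 * (d : ℝ) ≤ μ ^ p := by
    have : 1 * (d : ℝ) ≤ R ^ 4 * d := by gcongr
    linarith
  have hMm : μ ^ p ≤ m := by
    rw [← hμm]
    exact pow_le_pow_right₀ hμ1 (by omega)
  obtain ⟨Λ, hΛ1, hΛ2⟩ := lt_mul_of_lcs_lt hab hp hdpos ha hb (by
      have : (32 : ℝ) * d ≤ m := by linarith
      exact_mod_cast this) (fun X Y hXY => by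
      have h1 := hc X Y hXY
      have h2 : (lcs (W X) (W Y) : ℝ) < m + d := by linarith
      exact_mod_cast h2)
  have hΛμ : (Λ : ℝ) ≤ μ := by
    refine le_of_pow_le_pow_left₀ (n := p) (by omega) hμ0 ?_
    have : (Λ : ℝ) ^ p < 8 * d := by exact_mod_cast hΛ1
    linarith
  have hfin : (m : ℝ) < 983080 * R ^ 4 * Λ * d := by rw [hR]; exact_mod_cast hΛ2
  -- `Λ ≤ μ` and `983080 * R ^ 4 * d ≤ μ ^ p` multiply to `μ ^ (p + 1) = m`, contradicting `hfin`.
  have : 983080 * R ^ 4 * Λ * d ≤ m := by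
    calc 983080 * R ^ 4 * Λ * d ≤ 983080 * R ^ 4 * μ * d := by gcongr
      _ = μ * (983080 * (R ^ 4 * d)) := by ring
      _ ≤ μ * μ ^ p := by
          gcongr
          have : 0 ≤ R ^ 4 * d := by positivity
          linarith
      _ = m := by rw [← hμm]; ring
  linarith

end Bounds

/-! ### Families of balanced words and the minimum over tuples. -/

section Families

theorem lcs_le_lcsFamily {α : Type*} {t : ℕ} (W : Fin t → List α) {i j : Fin t} (h : i ≠ j) :
    lcs (W i) (W j) ≤ lcsFamily W := by
  refine le_csSup (Set.Finite.bddAbove ?_) ⟨i, j, h, rfl⟩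
  refine (Set.finite_range fun P : Fin t × Fin t => lcs (W P.1) (W P.2)).subset ?_
  rintro _ ⟨i, j, -, rfl⟩
  exact ⟨(i, j), rfl⟩

theorem le_lcsMin {α : Type*} {t : ℕ} {F : Set (List α)} (hF : F.Nonempty) {B : ℝ}
    (h : ∀ W : Fin t → List α, (∀ i, W i ∈ F) → ∃ i j, i ≠ j ∧ B ≤ lcs (W i) (W j)) :
    B ≤ lcsMin t F := by
  obtain ⟨w, hw⟩ := hF
  obtain ⟨W, hW, hm⟩ := Nat.sInf_mem
    (s := {m | ∃ W : Fin t → List α, (∀ i, W i ∈ F) ∧ lcsFamily W = m})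
    ⟨_, fun _ => w, fun _ => hw, rfl⟩
  obtain ⟨i, j, hij, hB⟩ := h W hW
  rw [lcsMin, ← hm]
  exact hB.trans (by exact_mod_cast lcs_le_lcsFamily W hij)

theorem mul_count_eq_of_mem_balancedWords {k n : ℕ} {w : List (Fin k)}
    (hw : w ∈ balancedWords k n) (i : Fin k) : k * w.count i = n := by
  have h := Multiset.sum_count_eq_card (s := Finset.univ) (m := (w : Multiset (Fin k)))
    (fun _ _ => Finset.mem_univ _)
  simp only [Multiset.coe_count, Multiset.coe_card] at h
  rw [Finset.sum_congr rfl fun j _ => hw.2 j i] at h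
  have hl : w.length = n := hw.1
  simpa [hl] using h

theorem exists_count_eq {k n : ℕ} (hk : 0 < k) (hF : (balancedWords k n).Nonempty) :
    ∃ m, n = k * m ∧ ∀ w ∈ balancedWords k n, ∀ i, w.count i = m := by
  obtain ⟨w, hw⟩ := hF
  refine ⟨w.count ⟨0, hk⟩, (mul_count_eq_of_mem_balancedWords hw _).symm, fun w' hw' i => ?_⟩
  refine Nat.eq_of_mul_eq_mul_left hk ?_
  rw [mul_count_eq_of_mem_balancedWords hw', mul_count_eq_of_mem_balancedWords hw]

theorem min_count_le_lcs {α : Type*} [DecidableEq α] (a : α) (u v : List α) :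
    min (u.count a) (v.count a) ≤ lcs u v :=
  (hasCommonSub_replicate (List.replicate_sublist_iff.2 le_rfl)
    (List.replicate_sublist_iff.2 le_rfl)).le_lcs

end Families

theorem theorem2 :
    (∃ a b : ℝ, 0 < a ∧ a ≤ b ∧
      ∀ k r : ℕ, 2 ≤ k → 1 ≤ r →
        ∃ c' : ℝ,
          a * ((r : ℝ) ^ (-9 : ℤ) * (k : ℝ) ^ (1 / (r : ℝ) - 1)) ≤ c' ∧
          c' ≤ b * ((r : ℝ) ^ (-9 : ℤ) * (k : ℝ) ^ (1 / (r : ℝ) - 1)) ∧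
          ∀ n : ℕ, (k : ℝ) * (10 * (r : ℝ)) ^ (9 * r) / 2 ≤ (n : ℝ) →
            (balancedWords k n).Nonempty →
            (n : ℝ) / (k : ℝ) + c' * (n : ℝ) ^ (1 - 1 / (r : ℝ)) ≤
              (lcsMin (r + 2) (balancedWords k n) : ℝ)) ∧
    (∀ k n : ℕ, 2 ≤ k → (balancedWords k n).Nonempty →
      (n : ℝ) / (k : ℝ) ≤ (lcsMin 2 (balancedWords k n) : ℝ)) := by
  refine ⟨⟨1 / 10 ^ 7, 1 / 10 ^ 7, by norm_num, le_rfl, fun k r hk hr =>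
    ⟨_, le_rfl, le_rfl, fun n hn hF => ?_⟩⟩, fun k n hk hF => ?_⟩
  · obtain ⟨m, rfl, hcount⟩ := exists_count_eq (by omega) hF
    have hk0 : (0 : ℝ) < k := by exact_mod_cast (show 0 < k by omega)
    refine le_lcsMin hF fun W hW => ?_
    obtain ⟨X, Y, hXY, h⟩ := exists_add_rpow_le_lcs (a := (⟨0, by omega⟩ : Fin k))
      (b := ⟨1, by omega⟩) (m := m) (by simp) hr (fun X => hcount _ (hW X) _)
      (fun X => hcount _ (hW X) _) (by
        push_cast at hn
        rw [mul_div_assoc] at hn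
        exact le_of_mul_le_mul_left hn hk0)
    refine ⟨X, Y, hXY, le_trans (le_of_eq ?_) h⟩
    push_cast
    rw [mul_div_cancel_left₀ _ hk0.ne', Real.mul_rpow hk0.le (Nat.cast_nonneg m)]
    -- The power of `k` in `c'` is exactly what turns `n ^ (1 - 1 / r)` into `m ^ (1 - 1 / r)` for
    -- `n = k * m`.
    have hcancel : (k : ℝ) ^ (1 / (r : ℝ) - 1) * (k : ℝ) ^ (1 - 1 / (r : ℝ)) = 1 := by
      rw [← Real.rpow_add hk0]
      simp
    linear_combination (1 / 10 ^ 7 * (r : ℝ) ^ (-9 : ℤ) * (m : ℝ) ^ (1 - 1 / (r : ℝ))) * hcancel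
  · obtain ⟨m, rfl, hcount⟩ := exists_count_eq (by omega) hF
    have hk0 : (0 : ℝ) < k := by exact_mod_cast (show 0 < k by omega)
    refine le_lcsMin hF fun W hW => ⟨0, 1, by simp, ?_⟩
    push_cast
    rw [mul_div_cancel_left₀ _ hk0.ne']
    have h := min_count_le_lcs (⟨0, by omega⟩ : Fin k) (W 0) (W 1)
    rw [hcount _ (hW 0), hcount _ (hW 1), min_self] at h
    exact_mod_cast h
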